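/- Directed graphs may have loops and parallel edges; $s(e)$ and $r(e)$ denote the source and range of an edge $e$. Paths are finite sequences of composable edges, a vertex being a path of length $0$. A cycle is a closed path of length at least $1$ whose edges have pairwise distinct sources (and pairwise distinct ranges); cycles are considered up to the choice of the starting vertex. A \emph{meteor graph} is a finite connected directed graph $E$ without sinks and sources that has exactly two cycles, these being vertex-disjoint, and that consists of the two cycles and the paths connecting them. One of the cycles, the \emph{source cycle} $C_0^E$, then has a path to the other one, the \emph{sink cycle} $C_1^E$. Let $p^E=|C_0^E|$ and $q^E=|C_1^E|$ be their lengths and let $\mathsf p_E=\gcd(p^E,q^E)$. A \emph{trail} of $E$ is a path $\alpha=e_0e_1\cdots e_k$ $(k\ge 0)$ from a vertex $s(\alpha)$ of $C_0^E$ to a vertex $r(\alpha)$ of $C_1^E$ such that $s(e_1),\dots,s(e_k)$ lie on neither cycle; its length is $|\alpha|=k+1$. For vertices $v$ of $C_0^E$ and $w$ of $C_1^E$ and $n\in\mathbb Z/\mathsf p_E$, let $N_E(n,v,w)$ be the number of trails $\alpha$ of $E$ with $$|v\,s(\alpha)|+|\alpha|+|r(\alpha)\,w|\equiv n \pmod{\mathsf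 p_E},$$ where $|x\,y|$ is the length of a shortest path from $x$ to $y$. For meteor graphs $E$ and $F$ write $E\approx F$ if $p^E=p^F$, $q^E=q^F$, and, with $\mathsf p=\mathsf p_E=\mathsf p_F$, for some choice of vertices $v^E\in C_0^E$, $w^E\in C_1^E$, $v^F\in C_0^F$, $w^F\in C_1^F$ there is $t\in\mathbb Z/\mathsf p$ such that $$N_E(n+t,v^E,w^E)=N_F(n,v^F,w^F)\qquad\text{for all } n\in\mathbb Z/\mathsf p .$$ An \emph{in-split} of a directed graph $E$ is a graph isomorphic to one obtained as follows. For each vertex $v$ with $r^{-1}(v)\neq\emptyset$ choose a partition of $r^{-1}(v)$ into nonempty sets $\mathscr E^v_1,\dots,\mathscr E^v_{m(v)}$; put $m(v)=1$ if $r^{-1}(v)=\emptyset$. The new graph has vertices $v_i$ ($v$ a vertex of $E$, $1\le i\le m(v)$) and edges $e_j$ ($e$ an edge of $E$, $1\le j\le m(s(e))$), with $s(e_j)=s(e)_j$ and $r(e_j)=r(e)_i$, where $e\in\mathscr E^{r(e)}_i$. An \emph{out-split} is defined in the same way after reversing all edges (in the original and the new graph). In- and out-amalgamations are the inverse operations.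 \textbf{Proposition.} Let $E$ and $F$ be meteor graphs. If $E\approx F$, then $E$ can be transformed into $F$ by a finite sequence of in-splits, out-splits, in-amalgamations and out-amalgamations. -/

import Mathlib

universe u v

/-- A directed graph (parallel edges and loops allowed): a type `V` of vertices, a type `E` of
edges, and source and range maps. -/
structure MultiDigraph where
  V : Type u
  E : Type v
  s : E → V
  r : E → V

namespace MultiDigraph

/-! ### Isomorphisms, transposes, splittings -/

/-- An isomorphism of directed graphs. -/
structure Iso (G H : MultiDigraph.{u, v}) where
  onV : G.V ≃ H.V
  onE : G.E ≃ H.E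
  map_s : ∀ e, H.s (onE e) = onV (G.s e)
  map_r : ∀ e, H.r (onE e) = onV (G.r e)

/-- The transpose graph: all edges are reversed. -/
def transpose (G : MultiDigraph.{u, v}) : MultiDigraph.{u, v} where
  V := G.V
  E := G.E
  s := G.r
  r := G.s

/-- The data of an in-splitting. For every vertex `v` with `r⁻¹(v) ≠ ∅`, a partition of `r⁻¹(v)`
into `m v` nonempty classes indexed by `Fin (m v)`; `cls e` is the index of the class that
contains the edge `e`. A vertex `v` with `r⁻¹(v) = ∅` is kept as one vertex, i.e. `m v = 1`. -/
structure InPartition (G : MultiDigraph.{u, v}) where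
  m : G.V → ℕ
  cls : (e : G.E) → Fin (m (G.r e))
  nonempty_cls : ∀ v : G.V, (∃ e, G.r e = v) →
    ∀ i : Fin (m v), ∃ e, G.r e = v ∧ (cls e : ℕ) = (i : ℕ)
  m_eq_one : ∀ v : G.V, (¬ ∃ e, G.r e = v) → m v = 1

/-- The in-split graph: vertices `v_i` and edges `e_j` with `1 ≤ i ≤ m(v)`, `1 ≤ j ≤ m(s(e))`,
`s(e_j) = s(e)_j`, and `r(e_j) = r(e)_i`, where `i` is the class of the edge `e`. -/
def inSplit (G : MultiDigraph.{u, v}) (P : G.InPartition) : MultiDigraph.{u, v} where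
  V := Σ v : G.V, Fin (P.m v)
  E := Σ e : G.E, Fin (P.m (G.s e))
  s := fun x => ⟨G.s x.1, x.2⟩
  r := fun x => ⟨G.r x.1, P.cls x.1⟩

/-- `H` is an in-split of `G` (equivalently, `G` is an in-amalgam of `H`); as usual, graphs are
considered up to isomorphism. -/
def IsInSplit (G H : MultiDigraph.{u, v}) : Prop :=
  ∃ P : G.InPartition, Nonempty (Iso (G.inSplit P) H)

/-- `H` is an out-split of `G` (equivalently, `G` is an out-amalgam of `H`). -/
def IsOutSplit (G H : MultiDigraph.{u, v}) : Prop :=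
  IsInSplit G.transpose H.transpose

/-- `H` arises from `G` by one in-split, in-amalgamation, out-split or out-amalgamation. -/
def Move (G H : MultiDigraph.{u, v}) : Prop :=
  IsInSplit G H ∨ IsInSplit H G ∨ IsOutSplit G H ∨ IsOutSplit H G

/-- `G` can be transformed into `H` by a finite sequence of in- and out-splits and
-amalgamations. -/
def TransformsInto (G H : MultiDigraph.{u, v}) : Prop :=
  Relation.ReflTransGen Move G H

/-! ### Paths and cycles -/

/-- `G.IsPath a l b`: the list of edges `l` is a path in `G` from `a` to `b`. The empty list is the
path of length `0` at any vertex. -/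
def IsPath (G : MultiDigraph.{u, v}) : G.V → List G.E → G.V → Prop
  | a, [], b => a = b
  | a, e :: l, b => G.s e = a ∧ G.IsPath (G.r e) l b

/-- The set of vertices that are the source or the range of one of the edges in `l`. -/
def verts (G : MultiDigraph.{u, v}) (l : List G.E) : Set G.V :=
  {x | ∃ e ∈ l, G.s e = x ∨ G.r e = x}

/-- A cycle: a closed path of length at least `1` along which neither the sources nor the ranges
of the edges repeat. -/
def IsCycle (G : MultiDigraph.{u, v}) (c : List G.E) : Prop :=
  c ≠ [] ∧ (∃ a, G.IsPath a c a) ∧ (c.map G.s).Nodup ∧ (c.map G.r).Nodup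

/-- The length of a shortest path from `a` to `b` (used only where there is such a path). -/
noncomputable def pathDist (G : MultiDigraph.{u, v}) (a b : G.V) : ℕ :=
  sInf {n | ∃ l, G.IsPath a l b ∧ l.length = n}

/-- Connectedness of the underlying undirected graph. -/
def Connected (G : MultiDigraph.{u, v}) : Prop :=
  Nonempty G.V ∧ ∀ a b : G.V, Relation.EqvGen (fun x y => ∃ e, G.s e = x ∧ G.r e = y) a b

/-- No sinks and no sources. -/
def Essential (G : MultiDigraph.{u, v}) : Prop :=
  ∀ a : G.V, (∃ e, G.s e = a) ∧ (∃ e, G.r e = a)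

/-! ### Meteor graphs -/

/-- `G` is a meteor graph with source cycle `c₀` and sink cycle `c₁`. -/
structure IsMeteorWith (G : MultiDigraph.{u, v}) (c₀ c₁ : List G.E) : Prop where
  finite_V : Finite G.V
  finite_E : Finite G.E
  essential : G.Essential
  connected : G.Connected
  cycle₀ : G.IsCycle c₀
  cycle₁ : G.IsCycle c₁
  disj : Disjoint (G.verts c₀) (G.verts c₁)
  /-- Up to the choice of a starting point, there are no other cycles. -/
  only_cycles : ∀ c, G.IsCycle c → c.IsRotated c₀ ∨ c.IsRotated c₁
  /-- Some path leads from `c₀` to `c₁`; this says which cycle is the source cycle. -/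
  source_to_sink : ∃ a ∈ G.verts c₀, ∃ b ∈ G.verts c₁, ∃ l, G.IsPath a l b
  /-- Apart from the two cycles, `G` consists of paths that connect them. -/
  edges : ∀ e, e ∈ c₀ ∨ e ∈ c₁ ∨
    ∃ a ∈ G.verts c₀, ∃ b ∈ G.verts c₁, ∃ l, G.IsPath a l b ∧ e ∈ l

/-- `G` is a meteor graph. -/
def IsMeteor (G : MultiDigraph.{u, v}) : Prop :=
  ∃ c₀ c₁, G.IsMeteorWith c₀ c₁

/-- `l` is a trail from `a` to `b`: a path of length at least `1` from a vertex `a` of `c₀` to a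
vertex `b` of `c₁` all of whose edges, except the first one, have their sources outside both
cycles. -/
def IsTrail (G : MultiDigraph.{u, v}) (c₀ c₁ : List G.E) (a : G.V) (l : List G.E) (b : G.V) :
    Prop :=
  l ≠ [] ∧ G.IsPath a l b ∧ a ∈ G.verts c₀ ∧ b ∈ G.verts c₁ ∧
    ∀ e ∈ l.tail, G.s e ∉ G.verts c₀ ∪ G.verts c₁

/-- The number of trails `α` with `|v s(α)| + |α| + |r(α) w| = n` modulo `d`. -/
noncomputable def trailCount (G : MultiDigraph.{u, v}) (c₀ c₁ : List G.E) (d : ℕ) (x y : G.V)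
    (n : ZMod d) : ℕ∞ :=
  {l : List G.E | ∃ a b, G.IsTrail c₀ c₁ a l b ∧
    ((G.pathDist x a + l.length + G.pathDist b y : ℕ) : ZMod d) = n}.encard

/-- The relation `(G, x, y) ≈ (H, x', y')` for pointed meteor graphs, where `G` has source cycle
`c₀` and sink cycle `c₁`, and `H` has source cycle `c₀'` and sink cycle `c₁'`. -/
def PointedApprox (G H : MultiDigraph.{u, v}) (c₀ c₁ : List G.E) (x y : G.V)
    (c₀' c₁' : List H.E) (x' y' : H.V) : Prop :=
  c₀.length = c₀'.length ∧ c₁.length = c₁'.length ∧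
    ∃ t : ZMod (Nat.gcd c₀.length c₁.length), ∀ n : ZMod (Nat.gcd c₀.length c₁.length),
      G.trailCount c₀ c₁ (Nat.gcd c₀.length c₁.length) x y (n + t) =
        H.trailCount c₀' c₁' (Nat.gcd c₀.length c₁.length) x' y' n

/-- The relation `G ≈ H` for meteor graphs: for some choice of a vertex on each of the four
cycles, the pointed meteor graphs are related. -/
def Approx (G H : MultiDigraph.{u, v}) : Prop :=
  ∃ (c₀ c₁ : List G.E) (c₀' c₁' : List H.E),
    G.IsMeteorWith c₀ c₁ ∧ H.IsMeteorWith c₀' c₁' ∧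
    ∃ x ∈ G.verts c₀, ∃ y ∈ G.verts c₁, ∃ x' ∈ H.verts c₀', ∃ y' ∈ H.verts c₁',
      PointedApprox G H c₀ c₁ x y c₀' c₁' x' y'

end MultiDigraph

/-!
The proof passes through strong shift equivalence of matrices over `ℕ`. If `A = R * S` and
`B = S * R`, where no row and no column of `R` and `S` is zero, then the graphs with adjacency
matrices `A` and `B` have a common splitting, whose vertices are the edges counted by `R`
(`transformsInto_mul_comm`). Two kinds of such factorizations suffice.

* In the adjacency matrix of a meteor graph, a vertex `t` off the cycles all of whose edges end in
  the sink cycle can be eliminated (`transformsInto_eliminate`). A path through `t` is replaced by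
  an edge that ends one vertex earlier on the sink cycle, so that the class of every trail modulo
  `gcd p q` is preserved. As there are no cycles off the two given ones, this can be repeated until
  the graph consists of two cycles and `M i j` edges from the vertex `i` of the source cycle to the
  vertex `j` of the sink cycle (`IsMeteorMatrix.exists_twoCycleMatrix`).

* For two-cycle graphs, with cycle matrices `P` and `Q`, the basic move leads from `M₁ + M₂` to
  `M₁ * Q + P * M₂` (`connEquiv_add`). Hence `M` can be replaced by `M * Q`, which shifts all
  classes by one, and any single connecting edge can be rotated along both cycles simultaneously. By
  the Chinese remainder theorem the orbits of this rotation are the classes of `i - j` modulo `gcd p q`.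
  So two matrices are equivalent as soon as their class sums agree up to a shift
  (`connEquiv_of_classSum_add_eq`).

The numbers of trails are followed through the elimination by means of a function `L` on the
vertices that counts the paths into the sink cycle and satisfies a recursion (`IsPathCount`). Since
trails are counted in `ℕ∞`, this needs no proof that there are only finitely many of them.
-/

namespace MultiDigraph

/-! ### Strong shift equivalence -/

theorem transformsInto_symm {G H : MultiDigraph.{u, v}} (h : G.TransformsInto H) :
    H.TransformsInto G := by
  have : Std.Symm Move.{u, v} := ⟨?_⟩
  · exact Std.Symm.symm (r := Relation.ReflTransGen Move.{u, v}) _ _ h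
  rintro G H (h | h | h | h)
  · exact Or.inr (Or.inl h)
  · exact Or.inl h
  · exact Or.inr (Or.inr (Or.inr h))
  · exact Or.inr (Or.inr (Or.inl h))

theorem Iso.transformsInto {G H : MultiDigraph.{u, v}} (f : Iso G H) : G.TransformsInto H := by
  refine Relation.ReflTransGen.single (Or.inl ⟨⟨fun _ => 1, fun _ => 0, ?_, fun _ _ => rfl⟩, ⟨?_⟩⟩)
  · rintro v ⟨e, he⟩ i
    exact ⟨e, he, by simp⟩
  · exact
      { onV := (Equiv.sigmaUnique _ _).trans f.onV
        onE := (Equiv.sigmaUnique _ _).trans f.onE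
        map_s := fun e => f.map_s e.1
        map_r := fun e => f.map_r e.1 }

/-- If the edges of `H` are the composable pairs of an edge in `S` and an edge in `R`, then the
in-splitting of `H` that sorts the edges by their `R`-part is the graph with vertex set `R` whose
edges are the composable triples in `R × S × R`. -/
theorem isInSplit_of_factorization {H C : MultiDigraph.{u, v}} {W R S : Type*} [Finite R]
    {rs : R → W} {rr : R → H.V} {ss : S → H.V} {sr : S → W}
    (eH : H.E ≃ {x : S × R // sr x.1 = rs x.2})
    (hs : ∀ e, H.s e = ss (eH e).1.1) (hr : ∀ e, H.r e = rr (eH e).1.2)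
    (cV : C.V ≃ R) (cE : C.E ≃ {x : R × S × R // rr x.1 = ss x.2.1 ∧ sr x.2.1 = rs x.2.2})
    (hcs : ∀ e, cV (C.s e) = (cE e).1.1) (hcr : ∀ e, cV (C.r e) = (cE e).1.2.2)
    (srr : Function.Surjective rr) (ssr : ∀ r, ∃ s, sr s = rs r) : IsInSplit H C := by
  let k : ∀ w : H.V, {r : R // rr r = w} ≃ Fin (Nat.card {r : R // rr r = w}) :=
    fun w => Finite.equivFin _
  -- The number that is given to `r` does not depend on the form of the vertex `rr r`.
  have hk : ∀ (w : H.V) (r : R) (h : rr r = w), (k w ⟨r, h⟩ : ℕ) = k (rr r) ⟨r, rfl⟩ := by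
    rintro w r rfl; rfl
  let P : H.InPartition :=
    { m := fun w => Nat.card {r : R // rr r = w}
      cls := fun e => k (H.r e) ⟨(eH e).1.2, (hr e).symm⟩
      nonempty_cls := by
        intro w _ i
        obtain ⟨⟨r, hrw⟩, rfl⟩ := (k w).surjective i
        obtain ⟨s, hsr⟩ := ssr r
        refine ⟨eH.symm ⟨(s, r), hsr⟩, by simp [hr, hrw], ?_⟩
        rw [hk, hk w]
        congr! 4 <;> simp
      m_eq_one := by
        intro w hw
        obtain ⟨r, rfl⟩ := srr w
        obtain ⟨s, hsr⟩ := ssr r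
        exact absurd ⟨eH.symm ⟨(s, r), hsr⟩, by simp [hr]⟩ hw }
  let fV : (Σ w : H.V, Fin (P.m w)) ≃ R :=
    (Equiv.sigmaCongrRight fun w => (k w).symm).trans (Equiv.sigmaFiberEquiv rr)
  have hfV : ∀ w i, fV ⟨w, i⟩ = ((k w).symm i).1 := fun w i => rfl
  let g : (Σ e : H.E, Fin (P.m (H.s e))) →
      {x : R × S × R // rr x.1 = ss x.2.1 ∧ sr x.2.1 = rs x.2.2} := fun x =>
    ⟨(((k _).symm x.2).1, (eH x.1).1.1, (eH x.1).1.2),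
      ((k _).symm x.2).2.trans (hs x.1), (eH x.1).2⟩
  have hg : Function.Bijective g := by
    constructor
    · rintro ⟨e, i⟩ ⟨e', i'⟩ h
      simp only [g, Subtype.mk.injEq, Prod.mk.injEq] at h
      obtain rfl : e = e' := eH.injective (Subtype.ext (Prod.ext h.2.1 h.2.2))
      congr 1
      exact (k _).symm.injective (Subtype.ext h.1)
    · rintro ⟨⟨r, s, r'⟩, h, h'⟩
      refine ⟨⟨eH.symm ⟨(s, r'), h'⟩, k _ ⟨r, by simp [hs, h]⟩⟩, ?_⟩
      simp [g]
  refine ⟨P, ⟨⟨fV.trans cV.symm, (Equiv.ofBijective g hg).trans cE.symm, ?_, ?_⟩⟩⟩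
  · intro x
    apply cV.injective
    rw [hcs]
    change (cE (cE.symm (g x))).1.1 = cV (cV.symm (fV _))
    rw [Equiv.apply_symm_apply, Equiv.apply_symm_apply]
    rfl
  · intro x
    apply cV.injective
    rw [hcr]
    change (cE (cE.symm (g x))).1.2.2 = cV (cV.symm (fV ⟨_, k _ _⟩))
    rw [Equiv.apply_symm_apply, Equiv.apply_symm_apply, hfV, Equiv.symm_apply_apply]

/-- Two graphs whose edges are the composable pairs in `R × S` and in `S × R`, respectively, have a
common splitting: its vertices are the elements of `R`. -/
theorem transformsInto_of_factorization {G H : MultiDigraph.{u, v}} {R S : Type} [Finite R]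
    {rs : R → G.V} {rr : R → H.V} {ss : S → H.V} {sr : S → G.V}
    (eG : G.E ≃ {x : R × S // rr x.1 = ss x.2})
    (hGs : ∀ e, G.s e = rs (eG e).1.1) (hGr : ∀ e, G.r e = sr (eG e).1.2)
    (eH : H.E ≃ {x : S × R // sr x.1 = rs x.2})
    (hHs : ∀ e, H.s e = ss (eH e).1.1) (hHr : ∀ e, H.r e = rr (eH e).1.2)
    (hrs : Function.Surjective rs) (hrr : Function.Surjective rr)
    (hss : Function.Surjective ss) (hsr : Function.Surjective sr) : G.TransformsInto H := by
  let C : MultiDigraph.{u, v} :=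
    { V := ULift.{u} R
      E := ULift.{v} {x : R × S × R // rr x.1 = ss x.2.1 ∧ sr x.2.1 = rs x.2.2}
      s := fun x => ⟨x.down.1.1⟩
      r := fun x => ⟨x.down.1.2.2⟩ }
  have hH : IsInSplit H C :=
    isInSplit_of_factorization eH hHs hHr Equiv.ulift Equiv.ulift (fun _ => rfl) (fun _ => rfl)
      hrr fun r => hsr _
  have hG : IsInSplit G.transpose C.transpose := by
    refine isInSplit_of_factorization (H := G.transpose) (W := H.V) (R := R) (S := S)
      (rs := rr) (rr := rs) (ss := sr) (sr := ss)
      (eG.trans ((Equiv.prodComm _ _).subtypeEquiv fun x => eq_comm)) hGr hGs Equiv.ulift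
      (Equiv.ulift.trans (Equiv.subtypeEquiv
        ⟨fun x => (x.2.2, x.2.1, x.1), fun x => (x.2.2, x.2.1, x.1), fun _ => rfl, fun _ => rfl⟩
        fun x => ⟨fun h => ⟨h.2.symm, h.1.symm⟩, fun h => ⟨h.2.symm, h.1.symm⟩⟩))
      (fun _ => rfl) (fun _ => rfl) hrs fun r => hss _
  have h₁ : Move G C := Or.inr (Or.inr (Or.inl hG))
  have h₂ : Move C H := Or.inr (Or.inl hH)
  exact (Relation.ReflTransGen.single h₁).tail h₂

/-- The graph with adjacency matrix `A`. The vertices are indexed by a type in the lowest universe,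
so that all graphs of this form, for given `u` and `v`, can be compared by `TransformsInto`. -/
def ofMatrix {V : Type} (A : Matrix V V ℕ) : MultiDigraph.{u, v} where
  V := ULift.{u} V
  E := ULift.{v} (Σ x : V × V, Fin (A x.1 x.2))
  s := fun e => ⟨e.down.1.1⟩
  r := fun e => ⟨e.down.1.2⟩

/-- A matrix is nondegenerate if it has no zero row and no zero column. -/
def Nondegenerate {V W : Type} (A : Matrix V W ℕ) : Prop :=
  (∀ v, ∃ w, A v w ≠ 0) ∧ ∀ w, ∃ v, A v w ≠ 0

/-- The entries of a product of matrices count the composable pairs. -/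
theorem exists_equiv_composable {V W : Type} [Fintype W] (R : Matrix V W ℕ)
    (S : Matrix W V ℕ) :
    ∃ f : (ofMatrix.{u, v} (R * S)).E ≃
      {x : (Σ a : V × W, Fin (R a.1 a.2)) × (Σ b : W × V, Fin (S b.1 b.2)) //
        (ULift.up x.1.1.2 : ULift.{u} W) = ULift.up x.2.1.1},
      ∀ e, (f e).1.1.1.1 = e.down.1.1 ∧ (f e).1.2.1.2 = e.down.1.2 := by
  have h : ∀ x : V × V, Nonempty (Fin ((R * S) x.1 x.2) ≃ Σ w, Fin (R x.1 w) × Fin (S w x.2)) := by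
    intro x
    refine ⟨Fintype.equivOfCardEq ?_⟩
    rw [Fintype.card_fin, Matrix.mul_apply]
    simp
  let g := fun x => (h x).some
  refine ⟨Equiv.ulift.trans ((Equiv.sigmaCongrRight g).trans
    ⟨fun y => ⟨(⟨(y.1.1, y.2.1), y.2.2.1⟩, ⟨(y.2.1, y.1.2), y.2.2.2⟩), rfl⟩, ?_, ?_, ?_⟩), ?_⟩
  · rintro ⟨⟨⟨⟨v, w⟩, a⟩, ⟨⟨w', v'⟩, b⟩⟩, h⟩
    obtain rfl : w = w' := ULift.up_injective h
    exact ⟨(v, v'), w, a, b⟩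
  · rintro ⟨⟨v, v'⟩, w, a, b⟩; rfl
  · rintro ⟨⟨⟨⟨v, w⟩, a⟩, ⟨⟨w', v'⟩, b⟩⟩, h⟩
    obtain rfl : w = w' := ULift.up_injective h
    rfl
  · intro e; exact ⟨rfl, rfl⟩

/-- An elementary strong shift equivalence is an out-splitting followed by an in-amalgamation. -/
theorem transformsInto_mul_comm {V W : Type} [Fintype V] [Fintype W] {R : Matrix V W ℕ}
    {S : Matrix W V ℕ} (hR : Nondegenerate R) (hS : Nondegenerate S) :
    (ofMatrix.{u, v} (R * S)).TransformsInto (ofMatrix (S * R)) := by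
  obtain ⟨f, hf⟩ := exists_equiv_composable.{u, v} R S
  obtain ⟨g, hg⟩ := exists_equiv_composable.{u, v} S R
  have key : ∀ n : ℕ, n ≠ 0 → Nonempty (Fin n) := fun n hn => ⟨⟨0, by omega⟩⟩
  refine transformsInto_of_factorization
    (G := ofMatrix.{u, v} (R * S)) (H := ofMatrix.{u, v} (S * R))
    (rs := fun x : Σ a : V × W, Fin (R a.1 a.2) => ⟨x.1.1⟩)
    (rr := fun x : Σ a : V × W, Fin (R a.1 a.2) => ⟨x.1.2⟩)
    (ss := fun x : Σ a : W × V, Fin (S a.1 a.2) => ⟨x.1.1⟩)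
    (sr := fun x : Σ a : W × V, Fin (S a.1 a.2) => ⟨x.1.2⟩)
    f
    (fun e => congrArg ULift.up (hf e).1.symm) (fun e => congrArg ULift.up (hf e).2.symm)
    g (fun e => congrArg ULift.up (hg e).1.symm) (fun e => congrArg ULift.up (hg e).2.symm)
    ?_ ?_ ?_ ?_
  · rintro ⟨v⟩
    obtain ⟨w, h⟩ := hR.1 v
    obtain ⟨a⟩ := key _ h
    exact ⟨⟨(v, w), a⟩, rfl⟩
  · rintro ⟨w⟩
    obtain ⟨v, h⟩ := hR.2 w
    obtain ⟨a⟩ := key _ h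
    exact ⟨⟨(v, w), a⟩, rfl⟩
  · rintro ⟨w⟩
    obtain ⟨v, h⟩ := hS.1 w
    obtain ⟨a⟩ := key _ h
    exact ⟨⟨(w, v), a⟩, rfl⟩
  · rintro ⟨v⟩
    obtain ⟨w, h⟩ := hS.2 v
    obtain ⟨a⟩ := key _ h
    exact ⟨⟨(w, v), a⟩, rfl⟩

/-- A finite graph is isomorphic to the graph of its adjacency matrix. -/
theorem exists_iso_ofMatrix {G : MultiDigraph.{u, v}} [Finite G.E] {V : Type} (φ : V ≃ G.V)
    (A : Matrix V V ℕ) (hA : ∀ a b, Nat.card {e // G.s e = φ a ∧ G.r e = φ b} = A a b) :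
    Nonempty (Iso G (ofMatrix A)) := by
  have h : ∀ x : V × V,
      Nonempty ({e : G.E // (φ.symm (G.s e), φ.symm (G.r e)) = x} ≃ Fin (A x.1 x.2)) := by
    intro x
    refine ⟨(Equiv.subtypeEquivRight fun e => ?_).trans
      ((Finite.equivFin _).trans (finCongr (hA x.1 x.2)))⟩
    rw [Prod.ext_iff, Equiv.symm_apply_eq, Equiv.symm_apply_eq]
  let g := fun x => (h x).some
  refine ⟨⟨φ.symm.trans Equiv.ulift.symm,
    ((Equiv.sigmaFiberEquiv fun e => (φ.symm (G.s e), φ.symm (G.r e))).symm.trans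
      (Equiv.sigmaCongrRight g)).trans Equiv.ulift.symm, fun e => rfl, fun e => rfl⟩⟩

theorem transformsInto_ofMatrix_reindex {V W : Type} (φ : V ≃ W) {A : Matrix V V ℕ}
    {B : Matrix W W ℕ} (h : ∀ a b, B (φ a) (φ b) = A a b) :
    (ofMatrix.{u, v} A).TransformsInto (ofMatrix B) := by
  refine Iso.transformsInto
    ⟨Equiv.ulift.trans (φ.trans Equiv.ulift.symm),
      Equiv.ulift.trans ((Equiv.sigmaCongr (φ.prodCongr φ)
        fun x => finCongr (h x.1 x.2).symm).trans Equiv.ulift.symm), fun e => rfl, fun e => rfl⟩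

/-! ### Graphs that consist of two cycles and connecting edges -/

/-- The adjacency matrix of a cycle of length `p`. -/
def cycleMatrix (p : ℕ) : Matrix (ZMod p) (ZMod p) ℕ :=
  Matrix.of fun i k => if k = i + 1 then 1 else 0

/-- The adjacency matrix of the graph that consists of two cycles, of lengths `p` and `q`, and of
`M i j` edges from the vertex `i` of the first cycle to the vertex `j` of the second one. -/
def twoCycleMatrix {p q : ℕ} (M : Matrix (ZMod p) (ZMod q) ℕ) :
    Matrix (ZMod p ⊕ ZMod q) (ZMod p ⊕ ZMod q) ℕ :=
  Matrix.fromBlocks (cycleMatrix p) M 0 (cycleMatrix q)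

/-- Two connection matrices are equivalent if the two-cycle graphs that they define can be
transformed into each other. -/
def ConnEquiv {p q : ℕ} (M M' : Matrix (ZMod p) (ZMod q) ℕ) : Prop :=
  (ofMatrix.{u, v} (twoCycleMatrix M)).TransformsInto (ofMatrix (twoCycleMatrix M'))

theorem nondegenerate_cycleMatrix (p : ℕ) : Nondegenerate (cycleMatrix p) :=
  ⟨fun i => ⟨i + 1, by simp [cycleMatrix]⟩, fun k => ⟨k - 1, by simp [cycleMatrix]⟩⟩

theorem nondegenerate_fromBlocks {V W V' W' : Type} {A : Matrix V W ℕ} {B : Matrix V W' ℕ}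
    {D : Matrix V' W' ℕ} (hA : Nondegenerate A) (hD : Nondegenerate D) :
    Nondegenerate (Matrix.fromBlocks A B 0 D) := by
  constructor
  · rintro (x | x)
    · obtain ⟨w, h⟩ := hA.1 x
      exact ⟨Sum.inl w, h⟩
    · obtain ⟨w, h⟩ := hD.1 x
      exact ⟨Sum.inr w, h⟩
  · rintro (x | x)
    · obtain ⟨w, h⟩ := hA.2 x
      exact ⟨Sum.inl w, h⟩
    · obtain ⟨w, h⟩ := hD.2 x
      exact ⟨Sum.inr w, h⟩

theorem nondegenerate_one {V : Type} [DecidableEq V] : Nondegenerate (1 : Matrix V V ℕ) :=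
  ⟨fun i => ⟨i, by simp⟩, fun i => ⟨i, by simp⟩⟩

theorem ConnEquiv.symm {p q : ℕ} {M M' : Matrix (ZMod p) (ZMod q) ℕ} (h : ConnEquiv.{u, v} M M') :
    ConnEquiv.{u, v} M' M :=
  transformsInto_symm h

theorem ConnEquiv.trans {p q : ℕ} {M M' M'' : Matrix (ZMod p) (ZMod q) ℕ}
    (h : ConnEquiv.{u, v} M M') (h' : ConnEquiv.{u, v} M' M'') : ConnEquiv.{u, v} M M'' :=
  Relation.ReflTransGen.trans h h'

theorem ConnEquiv.refl {p q : ℕ} (M : Matrix (ZMod p) (ZMod q) ℕ) : ConnEquiv.{u, v} M M :=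
  Relation.ReflTransGen.refl

theorem mul_cycleMatrix_apply {p q : ℕ} [NeZero q] (M : Matrix (ZMod p) (ZMod q) ℕ) (i : ZMod p)
    (j : ZMod q) :
    (M * cycleMatrix q) i j = M i (j - 1) := by
  rw [Matrix.mul_apply, Finset.sum_eq_single (j - 1)]
  · simp [cycleMatrix]
  · intro k _ hk
    have : j ≠ k + 1 := fun h => hk (by simp [h])
    simp [cycleMatrix, this]
  · simp

theorem cycleMatrix_mul_apply {p q : ℕ} [NeZero p] (M : Matrix (ZMod p) (ZMod q) ℕ) (i : ZMod p)
    (j : ZMod q) :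
    (cycleMatrix p * M) i j = M (i + 1) j := by
  simp [Matrix.mul_apply, cycleMatrix]

/-- The class modulo `gcd p q` of a connection from the vertex `i` of a cycle of length `p` to the
vertex `j` of a cycle of length `q`. It is the residue class of `i - j`, which does
not change if both cycles are rotated by the same number of steps. -/
def connClass {p q : ℕ} (i : ZMod p) (j : ZMod q) : ZMod (p.gcd q) :=
  ZMod.castHom (Nat.gcd_dvd_left p q) (ZMod (p.gcd q)) i -
    ZMod.castHom (Nat.gcd_dvd_right p q) (ZMod (p.gcd q)) j

section

variable {p q : ℕ} [NeZero p] [NeZero q]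

/-- The basic move, from which all others are composed. It comes from the factorization into the
block matrices `[[1, M₂], [0, Q]]` and `[[P, M₁], [0, 1]]`, where `P` and `Q` are the matrices of
the cycles. -/
theorem connEquiv_add (M₁ M₂ : Matrix (ZMod p) (ZMod q) ℕ) :
    ConnEquiv.{u, v} (M₁ + M₂) (M₁ * cycleMatrix q + cycleMatrix p * M₂) := by
  have h := transformsInto_mul_comm.{u, v}
    (nondegenerate_fromBlocks (B := M₂) (nondegenerate_one (V := ZMod p))
      (nondegenerate_cycleMatrix q))
    (nondegenerate_fromBlocks (B := M₁) (nondegenerate_cycleMatrix p)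
      (nondegenerate_one (V := ZMod q)))
  rw [Matrix.fromBlocks_multiply, Matrix.fromBlocks_multiply] at h
  simpa [ConnEquiv, twoCycleMatrix, add_comm] using h

theorem connEquiv_mul_cycleMatrix (M : Matrix (ZMod p) (ZMod q) ℕ) :
    ConnEquiv.{u, v} M (M * cycleMatrix q) := by
  simpa using connEquiv_add.{u, v} M 0

/-- A bundle of parallel connecting edges can be moved one step back along both cycles. -/
theorem connEquiv_add_single (M : Matrix (ZMod p) (ZMod q) ℕ) (i : ZMod p) (j : ZMod q) (m : ℕ) :
    ConnEquiv.{u, v} (M + Matrix.single (i + 1) (j + 1) m) (M + Matrix.single i j m) := by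
  refine (connEquiv_add _ _).trans ?_
  have : cycleMatrix p * Matrix.single (i + 1) (j + 1) m =
      Matrix.single i j m * cycleMatrix q := by
    ext a b
    rw [mul_cycleMatrix_apply, cycleMatrix_mul_apply]
    simp only [Matrix.single_apply, add_left_inj]
    congr 2
    rw [eq_sub_iff_add_eq]
  rw [this, ← Matrix.add_mul]
  exact (connEquiv_mul_cycleMatrix _).symm

theorem connEquiv_add_single_nat (M : Matrix (ZMod p) (ZMod q) ℕ) (i : ZMod p) (j : ZMod q)
    (m k : ℕ) :
    ConnEquiv.{u, v} (M + Matrix.single (i + k) (j + k) m) (M + Matrix.single i j m) := by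
  induction k with
  | zero => simpa using ConnEquiv.refl _
  | succ k ih =>
    push_cast
    rw [← add_assoc, ← add_assoc]
    exact (connEquiv_add_single _ _ _ _).trans ih

/-- By the Chinese remainder theorem, the orbits of the simultaneous rotation of both cycles are the
fibres of `connClass`. -/
theorem exists_nat_add_eq {i i' : ZMod p} {j j' : ZMod q}
    (h : connClass i j = connClass i' j') :
    ∃ k : ℕ, i' + k = i ∧ j' + k = j := by
  unfold connClass at h
  have h' : (i - i').val ≡ (j - j').val [MOD p.gcd q] := by
    rw [← ZMod.natCast_eq_natCast_iff]
    have h₁ := map_natCast (ZMod.castHom (Nat.gcd_dvd_left p q) (ZMod (p.gcd q))) (i - i').val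
    have h₂ := map_natCast (ZMod.castHom (Nat.gcd_dvd_right p q) (ZMod (p.gcd q))) (j - j').val
    rw [← h₁, ← h₂, ZMod.natCast_zmod_val, ZMod.natCast_zmod_val, map_sub, map_sub]
    linear_combination h
  obtain ⟨k, hk, hk'⟩ := Nat.chineseRemainder' h'
  refine ⟨k, ?_, ?_⟩
  · rw [← ZMod.natCast_eq_natCast_iff, ZMod.natCast_zmod_val] at hk
    rw [hk]; ring
  · rw [← ZMod.natCast_eq_natCast_iff, ZMod.natCast_zmod_val] at hk'
    rw [hk']; ring

theorem connEquiv_add_single_of_connClass_eq (M : Matrix (ZMod p) (ZMod q) ℕ) (m : ℕ)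
    {i i' : ZMod p} {j j' : ZMod q} (h : connClass i j = connClass i' j') :
    ConnEquiv.{u, v} (M + Matrix.single i j m) (M + Matrix.single i' j' m) := by
  obtain ⟨k, rfl, rfl⟩ := exists_nat_add_eq h
  exact connEquiv_add_single_nat M i' j' m k

/-- The number of connecting edges of class `n`. -/
def classSum (M : Matrix (ZMod p) (ZMod q) ℕ) (n : ZMod (p.gcd q)) : ℕ :=
  ∑ x : ZMod p × ZMod q, if connClass x.1 x.2 = n then M x.1 x.2 else 0

/-- All connecting edges can be moved, one orbit of the simultaneous rotation at a time, to a chosen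
representative of the orbit. -/
theorem connEquiv_sum_single (M : Matrix (ZMod p) (ZMod q) ℕ) :
    ConnEquiv.{u, v} M (∑ x : ZMod p × ZMod q, Matrix.single
      (((connClass x.1 x.2).val : ℕ) : ZMod p) (0 : ZMod q) (M x.1 x.2)) := by
  have : NeZero (p.gcd q) := ⟨(Nat.gcd_pos_of_pos_left _ (NeZero.pos p)).ne'⟩
  have key : ∀ (s : Finset (ZMod p × ZMod q)) (N : Matrix (ZMod p) (ZMod q) ℕ),
      ConnEquiv.{u, v} (N + ∑ x ∈ s, Matrix.single x.1 x.2 (M x.1 x.2))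
        (N + ∑ x ∈ s, Matrix.single
          (((connClass x.1 x.2).val : ℕ) : ZMod p) (0 : ZMod q) (M x.1 x.2)) := by
    intro s
    induction s using Finset.induction_on with
    | empty => intro N; simpa using ConnEquiv.refl _
    | insert x s hx ih =>
      intro N
      rw [Finset.sum_insert hx, Finset.sum_insert hx, ← add_assoc]
      refine (ih _).trans ?_
      rw [add_right_comm, ← add_assoc, add_right_comm N (Matrix.single _ (0 : ZMod q) _)]
      refine connEquiv_add_single_of_connClass_eq _ _ ?_
      conv_rhs => rw [connClass, map_natCast, ZMod.natCast_zmod_val, map_zero, sub_zero]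
  have h := key Finset.univ 0
  rw [zero_add, zero_add] at h
  convert h using 1
  rw [Fintype.sum_prod_type]
  exact Matrix.matrix_eq_sum_single M

/-- The normal form of `connEquiv_sum_single` depends only on the class sums. -/
theorem connEquiv_of_classSum_eq {M M' : Matrix (ZMod p) (ZMod q) ℕ}
    (h : ∀ n, classSum M n = classSum M' n) : ConnEquiv.{u, v} M M' := by
  have : NeZero (p.gcd q) := ⟨(Nat.gcd_pos_of_pos_left _ (NeZero.pos p)).ne'⟩
  have key : ∀ N : Matrix (ZMod p) (ZMod q) ℕ, (∑ x : ZMod p × ZMod q, Matrix.single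
      (((connClass x.1 x.2).val : ℕ) : ZMod p) (0 : ZMod q) (N x.1 x.2)) =
      ∑ n : ZMod (p.gcd q), Matrix.single ((n.val : ℕ) : ZMod p) (0 : ZMod q) (classSum N n) := by
    intro N
    have : ∀ n : ZMod (p.gcd q),
        Matrix.single ((n.val : ℕ) : ZMod p) (0 : ZMod q) (classSum N n) =
        ∑ x : ZMod p × ZMod q, if connClass x.1 x.2 = n then
            Matrix.single ((n.val : ℕ) : ZMod p) (0 : ZMod q) (N x.1 x.2) else 0 := by
      intro n
      rw [classSum, ← Matrix.singleAddMonoidHom_apply, map_sum]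
      refine Finset.sum_congr rfl fun x _ => ?_
      split_ifs <;> simp
    simp_rw [this]
    rw [Finset.sum_comm]
    refine Finset.sum_congr rfl fun x _ => ?_
    rw [Finset.sum_ite_eq]
    simp
  have h₁ := connEquiv_sum_single.{u, v} M
  have h₂ := connEquiv_sum_single.{u, v} M'
  rw [key] at h₁ h₂
  simp_rw [h] at h₁
  exact h₁.trans h₂.symm

/-- Rotating the second cycle shifts the class sums. -/
theorem classSum_mul_cycleMatrix (M : Matrix (ZMod p) (ZMod q) ℕ) (n : ZMod (p.gcd q)) :
    classSum (M * cycleMatrix q) n = classSum M (n + 1) := by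
  unfold classSum connClass
  refine Fintype.sum_equiv ((Equiv.refl _).prodCongr (Equiv.subRight 1)) _ _ fun x => ?_
  simp only [mul_cycleMatrix_apply, Equiv.prodCongr_apply, Prod.map, Equiv.refl_apply,
    Equiv.subRight_apply, map_sub, map_one]
  congr 1
  rw [sub_sub_eq_add_sub, add_sub_right_comm, add_left_inj]

theorem connEquiv_of_classSum_add_eq {M M' : Matrix (ZMod p) (ZMod q) ℕ} (t : ZMod (p.gcd q))
    (h : ∀ n, classSum M (n + t) = classSum M' n) : ConnEquiv.{u, v} M M' := by
  have : NeZero (p.gcd q) := ⟨(Nat.gcd_pos_of_pos_left _ (NeZero.pos p)).ne'⟩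
  have key : ∀ (k : ℕ) (M : Matrix (ZMod p) (ZMod q) ℕ),
      (∀ n, classSum M (n + k) = classSum M' n) → ConnEquiv.{u, v} M M' := by
    intro k
    induction k with
    | zero => intro M h; exact connEquiv_of_classSum_eq (by simpa using h)
    | succ k ih =>
      intro M h
      refine (connEquiv_mul_cycleMatrix M).trans (ih _ fun n => ?_)
      rw [classSum_mul_cycleMatrix, ← h]
      push_cast
      rw [add_assoc]
  exact key t.val M (by simpa using h)

end

/-! ### Elimination of the vertices off the cycles -/

/-- The adjacency matrix `A` of a meteor graph: its source cycle is parametrized by `c₀`, its sink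
cycle by `c₁`. The source cycle receives no edges and the sink cycle emits no edges except for their
own; the function `ρ` witnesses that there are no further cycles. -/
structure IsMeteorMatrix {p q : ℕ} {V : Type} [DecidableEq V] (A : Matrix V V ℕ) (c₀ : ZMod p → V)
    (c₁ : ZMod q → V) : Prop where
  inj₀ : Function.Injective c₀
  inj₁ : Function.Injective c₁
  disj : ∀ i j, c₀ i ≠ c₁ j
  col₀ : ∀ v i, A v (c₀ i) = if v = c₀ (i - 1) then 1 else 0
  row₁ : ∀ j v, A (c₁ j) v = if v = c₁ (j + 1) then 1 else 0
  nondegenerate : Nondegenerate A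
  exists_rank : ∃ ρ : V → ℕ, ∀ v w, A v w ≠ 0 → v ∉ Set.range c₀ → v ∉ Set.range c₁ →
    w ∉ Set.range c₁ → ρ w < ρ v

/-- The characteristic equations for the function `L` which counts, for a vertex `v` and a class `n`
modulo `gcd p q`, the paths from `v` to the sink cycle that avoid the source cycle and stop as soon
as they meet the sink cycle. The class of a path that ends in `c₁ j` is its length minus `j`. -/
structure IsPathCount {p q : ℕ} {V : Type} [Fintype V] (A : Matrix V V ℕ) (c₀ : ZMod p → V)
    (c₁ : ZMod q → V) (L : V → ZMod (p.gcd q) → ℕ∞) : Prop where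
  source : ∀ i n, L (c₀ i) n = 0
  sink : ∀ j n, L (c₁ j) n = if connClass (0 : ZMod p) j = n then 1 else 0
  step : ∀ v, v ∉ Set.range c₀ → v ∉ Set.range c₁ → ∀ n, L v n = ∑ w, A v w * L w (n - 1)

/-- The number of trails of class `n`, in terms of the function `L` that counts the paths from
their second vertex on. -/
def trailSum {p q : ℕ} [NeZero p] {V : Type} [Fintype V] (A : Matrix V V ℕ) (c₀ : ZMod p → V)
    (L : V → ZMod (p.gcd q) → ℕ∞) (n : ZMod (p.gcd q)) : ℕ∞ :=
  ∑ i, ∑ w, A (c₀ i) w * L w (n - 1 - connClass i (0 : ZMod q))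

/-- The edges that emanate from a vertex `t` and end in the sink cycle, with their ranges moved one
step back along the cycle. -/
def pulledRow {q : ℕ} [NeZero q] {V : Type} [DecidableEq V] (A : Matrix V V ℕ)
    (c₁ : ZMod q → V) (t w : V) : ℕ :=
  ∑ j, if w = c₁ j then A t (c₁ (j + 1)) else 0

theorem pulledRow_apply {q : ℕ} [NeZero q] {V : Type} [DecidableEq V]
    {A : Matrix V V ℕ} {c₁ : ZMod q → V}
    (h₁ : Function.Injective c₁) (t : V) (j : ZMod q) :
    pulledRow A c₁ t (c₁ j) = A t (c₁ (j + 1)) := by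
  simp [pulledRow, h₁.eq_iff]

theorem pulledRow_of_notMem {q : ℕ} [NeZero q] {V : Type} [DecidableEq V]
    {A : Matrix V V ℕ} {c₁ : ZMod q → V}
    (t : V) {w : V} (hw : w ∉ Set.range c₁) : pulledRow A c₁ t w = 0 :=
  Finset.sum_eq_zero fun j _ => if_neg fun h => hw ⟨j, h.symm⟩

/-- A vertex `t` off the cycles all of whose edges end in the sink cycle can be eliminated: every
path of length two from a vertex `v` through `t` to a vertex `w` of the sink cycle is replaced by an
edge from `v` to the predecessor of `w`. The matrix `R` below sends `t` to its pulled back row and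
fixes the other vertices, and `S` consists of the rows of `A` other than the one of `t`. -/
theorem transformsInto_eliminate {p q : ℕ} [NeZero q] {V : Type} [Fintype V] [DecidableEq V]
    {A : Matrix V V ℕ}
    {c₀ : ZMod p → V} {c₁ : ZMod q → V} (hA : IsMeteorMatrix A c₀ c₁) {t : V}
    (ht₁ : t ∉ Set.range c₁) (ht : ∀ w, w ∉ Set.range c₁ → A t w = 0) :
    (ofMatrix.{u, v} A).TransformsInto (ofMatrix (Matrix.of fun v w : {v // v ≠ t} =>
      A v w + A v t * pulledRow A c₁ t w)) := by
  have htt : A t t = 0 := ht t ht₁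
  let R : Matrix V {v // v ≠ t} ℕ := Matrix.of fun v w =>
    if v = t then pulledRow A c₁ t w else if v = w then 1 else 0
  let S : Matrix {v // v ≠ t} V ℕ := Matrix.of fun v w => A v w
  have hsplit : ∀ f : V → ℕ, ∑ v, f v = f t + ∑ v : {v // v ≠ t}, f v := fun f =>
    Fintype.sum_eq_add_sum_subtype_ne f t
  have hRS : R * S = A := by
    ext v w
    rw [Matrix.mul_apply]
    by_cases hv : v = t
    · subst hv
      simp only [R, S, Matrix.of_apply, if_true]
      have := hsplit fun x => pulledRow A c₁ v x * A x w
      rw [show ∑ x : {x // x ≠ v}, pulledRow A c₁ v x * A x w =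
        ∑ x, pulledRow A c₁ v x * A x w by
          rw [this, pulledRow_of_notMem v ht₁, zero_mul, zero_add]]
      simp only [pulledRow, Finset.sum_mul]
      rw [Finset.sum_comm]
      simp only [ite_mul, zero_mul, Finset.sum_ite_eq', Finset.mem_univ, if_true, hA.row₁]
      by_cases hw : w ∈ Set.range c₁
      · obtain ⟨j, rfl⟩ := hw
        rw [Finset.sum_eq_single (j - 1)]
        · simp
        · intro k _ hk
          rw [if_neg, mul_zero]
          intro h
          exact hk (by rw [hA.inj₁ h]; simp)
        · simp
      · rw [ht w hw]
        refine Finset.sum_eq_zero fun j _ => ?_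
        rw [if_neg, mul_zero]
        rintro rfl
        exact hw ⟨_, rfl⟩
    · rw [Finset.sum_eq_single ⟨v, hv⟩]
      · simp [R, S, hv]
      · intro x _ hx
        have : v ≠ x := fun h => hx (Subtype.ext h.symm)
        simp [R, hv, this]
      · simp
  have hSR : S * R = Matrix.of fun v w : {v // v ≠ t} => A v w + A v t * pulledRow A c₁ t w := by
    ext v w
    rw [Matrix.mul_apply, hsplit, add_comm]
    simp only [R, S, Matrix.of_apply, if_true]
    congr 1
    rw [Finset.sum_eq_single w]
    · simp [w.2]
    · intro x _ hx
      have : (x : V) ≠ w := fun h => hx (Subtype.ext h)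
      simp [x.2, this]
    · simp
  have h := transformsInto_mul_comm.{u, v} (R := R) (S := S) ?_ ?_
  · rwa [hRS, hSR] at h
  · refine ⟨fun v => ?_, fun w => ⟨w, by simp [R, w.2]⟩⟩
    by_cases hv : v = t
    · subst hv
      obtain ⟨w, hw⟩ := hA.nondegenerate.1 v
      by_contra! hR
      refine hw ?_
      rw [← hRS, Matrix.mul_apply]
      exact Finset.sum_eq_zero fun x _ => by rw [hR, zero_mul]
    · exact ⟨⟨v, hv⟩, by simp [R, hv]⟩
  · refine ⟨fun v => hA.nondegenerate.1 v, fun w => ?_⟩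
    by_contra! hS
    obtain ⟨v, hv⟩ := hA.nondegenerate.2 w
    by_cases hvt : v = t
    · subst hvt
      have hw : w ∈ Set.range c₁ := by
        by_contra hw
        exact hv (ht w hw)
      obtain ⟨j, rfl⟩ := hw
      have := hS ⟨c₁ (j - 1), fun h => ht₁ ⟨_, h⟩⟩
      simp [S, hA.row₁] at this
    · exact hv (hS ⟨v, hvt⟩)

theorem IsMeteorMatrix.exists_twoCycleMatrix_of_forall_mem {p q : ℕ} [NeZero p] [NeZero q]
    {V : Type} [Fintype V] [DecidableEq V]
    {A : Matrix V V ℕ} {c₀ : ZMod p → V} {c₁ : ZMod q → V} {L : V → ZMod (p.gcd q) → ℕ∞}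
    (hA : IsMeteorMatrix A c₀ c₁) (hL : IsPathCount A c₀ c₁ L)
    (hV : ∀ v, v ∈ Set.range c₀ ∨ v ∈ Set.range c₁) :
    ∃ M : Matrix (ZMod p) (ZMod q) ℕ,
      (ofMatrix.{u, v} A).TransformsInto (ofMatrix (twoCycleMatrix M)) ∧
      ∀ n, trailSum A c₀ L n = classSum M (n - 1) := by
  let φ : ZMod p ⊕ ZMod q ≃ V := Equiv.ofBijective (Sum.elim c₀ c₁)
    ⟨hA.inj₀.sumElim hA.inj₁ hA.disj, by
      intro v
      rcases hV v with ⟨i, rfl⟩ | ⟨j, rfl⟩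
      · exact ⟨Sum.inl i, rfl⟩
      · exact ⟨Sum.inr j, rfl⟩⟩
  refine ⟨Matrix.of fun i j => A (c₀ i) (c₁ j), transformsInto_symm
    (transformsInto_ofMatrix_reindex φ ?_), fun n => ?_⟩
  · rintro (i | j) (k | l)
    · change A (c₀ i) (c₀ k) = cycleMatrix p i k
      simp only [hA.col₀, hA.inj₀.eq_iff, eq_sub_iff_add_eq, cycleMatrix, Matrix.of_apply,
        eq_comm]
    · rfl
    · change A (c₁ j) (c₀ k) = 0
      rw [hA.row₁, if_neg (hA.disj _ _)]
    · change A (c₁ j) (c₁ l) = cycleMatrix q j l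
      simp only [hA.row₁, hA.inj₁.eq_iff, cycleMatrix, Matrix.of_apply]
  · rw [trailSum, classSum, Fintype.sum_prod_type, Nat.cast_sum]
    refine Finset.sum_congr rfl fun i _ => ?_
    rw [← φ.sum_comp, Fintype.sum_sum_type, Finset.sum_eq_zero, zero_add, Nat.cast_sum]
    · refine Finset.sum_congr rfl fun j _ => ?_
      change (A (c₀ i) (c₁ j) : ℕ∞) * L (c₁ j) _ = _
      have : connClass (0 : ZMod p) j = n - 1 - connClass i (0 : ZMod q) ↔
          connClass i j = n - 1 := by
        rw [eq_sub_iff_add_eq]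
        simp only [connClass, map_zero, sub_zero, zero_sub, neg_add_eq_sub]
      rw [hL.sink]
      simp only [this]
      split_ifs <;> simp
    · intro k _
      change (A (c₀ i) (c₀ k) : ℕ∞) * L (c₀ k) _ = _
      rw [hL.source, mul_zero]

/-- Pulling back the range of an edge along the sink cycle leaves the class of paths unchanged. -/
theorem sum_pulledRow_mul {p q : ℕ} [NeZero q] {V : Type} [Fintype V] [DecidableEq V]
    {A : Matrix V V ℕ} {c₀ : ZMod p → V} {c₁ : ZMod q → V} {L : V → ZMod (p.gcd q) → ℕ∞}
    (hA : IsMeteorMatrix A c₀ c₁) (hL : IsPathCount A c₀ c₁ L) {t : V}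
    (ht₀ : t ∉ Set.range c₀) (ht₁ : t ∉ Set.range c₁) (ht : ∀ w, w ∉ Set.range c₁ → A t w = 0)
    (n : ZMod (p.gcd q)) : ∑ w, (pulledRow A c₁ t w : ℕ∞) * L w n = L t n := by
  rw [hL.step t ht₀ ht₁]
  rw [← Fintype.sum_of_injective c₁ hA.inj₁ (fun j => (A t (c₁ (j + 1)) : ℕ∞) * L (c₁ j) n),
    ← Fintype.sum_of_injective c₁ hA.inj₁ (fun j => (A t (c₁ j) : ℕ∞) * L (c₁ j) (n - 1))]
  · refine Fintype.sum_equiv (Equiv.addRight 1) _ _ fun j => ?_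
    rw [Equiv.coe_addRight, hL.sink, hL.sink]
    congr 2
    simp only [connClass, map_add, map_one, eq_iff_iff, eq_sub_iff_add_eq]
    rw [sub_add_eq_sub_sub, sub_add_cancel]
  · intro w hw
    rw [ht w hw, Nat.cast_zero, zero_mul]
  · exact fun _ => rfl
  · intro w hw
    rw [pulledRow_of_notMem t hw, Nat.cast_zero, zero_mul]
  · intro j
    rw [pulledRow_apply hA.inj₁]

/-- The elimination of a vertex does not change the sums that count paths. -/
theorem sum_eliminate_mul {p q : ℕ} [NeZero q] {V : Type} [Fintype V] [DecidableEq V]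
    {A : Matrix V V ℕ} {c₀ : ZMod p → V} {c₁ : ZMod q → V} {L : V → ZMod (p.gcd q) → ℕ∞}
    (hA : IsMeteorMatrix A c₀ c₁) (hL : IsPathCount A c₀ c₁ L) {t : V}
    (ht₀ : t ∉ Set.range c₀) (ht₁ : t ∉ Set.range c₁) (ht : ∀ w, w ∉ Set.range c₁ → A t w = 0)
    (v : V) (n : ZMod (p.gcd q)) :
    ∑ w : {w // w ≠ t}, ((A v w + A v t * pulledRow A c₁ t w : ℕ) : ℕ∞) * L w n =
      ∑ w, (A v w : ℕ∞) * L w n := by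
  have h₁ := Fintype.sum_eq_add_sum_subtype_ne (fun w => (A v w : ℕ∞) * L w n) t
  have h₂ := Fintype.sum_eq_add_sum_subtype_ne (fun w => (pulledRow A c₁ t w : ℕ∞) * L w n) t
  rw [pulledRow_of_notMem t ht₁, Nat.cast_zero, zero_mul, zero_add,
    sum_pulledRow_mul hA hL ht₀ ht₁ ht] at h₂
  rw [h₁, h₂, Finset.mul_sum, add_comm, ← Finset.sum_add_distrib]
  refine Finset.sum_congr rfl fun w _ => ?_
  push_cast
  ring

theorem IsMeteorMatrix.eliminate {p q : ℕ} [NeZero q] {V : Type} [DecidableEq V]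
    {A : Matrix V V ℕ} {c₀ : ZMod p → V} {c₁ : ZMod q → V}
    (hA : IsMeteorMatrix A c₀ c₁) {t : V}
    (ht₀ : ∀ i, c₀ i ≠ t) (ht₁ : ∀ j, c₁ j ≠ t) (ht : ∀ w, w ∉ Set.range c₁ → A t w = 0) :
    IsMeteorMatrix (Matrix.of fun v w : {v // v ≠ t} => A v w + A v t * pulledRow A c₁ t w)
      (fun i => ⟨c₀ i, ht₀ i⟩) (fun j => ⟨c₁ j, ht₁ j⟩) where
  inj₀ i k h := hA.inj₀ (congrArg Subtype.val h)
  inj₁ i k h := hA.inj₁ (congrArg Subtype.val h)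
  disj i j h := hA.disj i j (congrArg Subtype.val h)
  col₀ v i := by
    have : pulledRow A c₁ t (c₀ i) = 0 := pulledRow_of_notMem t fun ⟨j, h⟩ => hA.disj i j h.symm
    simp [this, hA.col₀, Subtype.ext_iff]
  row₁ j v := by
    have : A (c₁ j) t = 0 := by rw [hA.row₁, if_neg (ht₁ _).symm]
    simp [this, hA.row₁, Subtype.ext_iff]
  nondegenerate := by
    constructor
    · intro v
      obtain ⟨w, hw⟩ := hA.nondegenerate.1 v
      by_cases hwt : w = t
      · subst hwt
        obtain ⟨x, hx⟩ := hA.nondegenerate.1 w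
        have hx' : x ∈ Set.range c₁ := by
          by_contra h
          exact hx (ht x h)
        obtain ⟨j, rfl⟩ := hx'
        refine ⟨⟨c₁ (j - 1), ht₁ _⟩, ?_⟩
        simp [pulledRow_apply hA.inj₁, hw, hx]
      · exact ⟨⟨w, hwt⟩, by simp [hw]⟩
    · intro w
      obtain ⟨v, hv⟩ := hA.nondegenerate.2 w
      by_cases hvt : v = t
      · subst hvt
        have hw' : w.1 ∈ Set.range c₁ := by
          by_contra h
          exact hv (ht w h)
        obtain ⟨j, hj⟩ := hw'
        refine ⟨⟨c₁ (j - 1), ht₁ _⟩, ?_⟩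
        simp [← hj, hA.row₁]
      · exact ⟨⟨v, hvt⟩, by simp [hv]⟩
  exists_rank := by
    obtain ⟨ρ, hρ⟩ := hA.exists_rank
    refine ⟨fun v => ρ v, fun v w h h₀ h₁ hw => ?_⟩
    have hw' : w.1 ∉ Set.range c₁ := fun ⟨j, hj⟩ => hw ⟨j, Subtype.ext hj⟩
    rw [Matrix.of_apply, pulledRow_of_notMem t hw', mul_zero, add_zero] at h
    exact hρ v w h (fun ⟨j, hj⟩ => h₀ ⟨j, Subtype.ext hj⟩) (fun ⟨j, hj⟩ => h₁ ⟨j, Subtype.ext hj⟩)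
      hw'

/-- Every meteor graph can be transformed into a graph that consists of two cycles and of edges that
connect them, and the class sums of the connection matrix are the trail sums. The vertices off the
cycles are eliminated one by one. -/
theorem IsMeteorMatrix.exists_twoCycleMatrix {p q : ℕ} [NeZero p] [NeZero q]
    {V : Type} [Fintype V] [DecidableEq V]
    {A : Matrix V V ℕ} {c₀ : ZMod p → V} {c₁ : ZMod q → V} {L : V → ZMod (p.gcd q) → ℕ∞}
    (hA : IsMeteorMatrix A c₀ c₁) (hL : IsPathCount A c₀ c₁ L) :
    ∃ M : Matrix (ZMod p) (ZMod q) ℕ,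
      (ofMatrix.{u, v} A).TransformsInto (ofMatrix (twoCycleMatrix M)) ∧
      ∀ n, trailSum A c₀ L n = classSum M (n - 1) := by
  induction hk : Fintype.card V generalizing V with
  | zero => exact ((Fintype.card_eq_zero_iff.mp hk).false (c₀ 0)).elim
  | succ k ih =>
    by_cases hV : ∀ v, v ∈ Set.range c₀ ∨ v ∈ Set.range c₁
    · exact hA.exists_twoCycleMatrix_of_forall_mem hL hV
    push Not at hV
    obtain ⟨ρ, hρ⟩ := hA.exists_rank
    -- All edges of a vertex `t` of minimal rank off the cycles end in the sink cycle.
    obtain ⟨t, ⟨ht₀, ht₁⟩, hmin⟩ :=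
      WellFounded.has_min (measure ρ).wf {v | v ∉ Set.range c₀ ∧ v ∉ Set.range c₁} hV
    have ht : ∀ w, w ∉ Set.range c₁ → A t w = 0 := by
      intro w hw
      by_contra h
      by_cases hw₀ : w ∈ Set.range c₀
      · obtain ⟨i, rfl⟩ := hw₀
        rw [hA.col₀] at h
        exact ht₀ ⟨i - 1, by simpa [eq_comm] using h⟩
      · exact hmin w ⟨hw₀, hw⟩ (hρ t w h ht₀ ht₁ hw)
    have ht₀' : ∀ i, c₀ i ≠ t := fun i h => ht₀ ⟨i, h⟩
    have ht₁' : ∀ i, c₁ i ≠ t := fun i h => ht₁ ⟨i, h⟩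
    have hcard : Fintype.card {v // v ≠ t} = k := by
      rw [Fintype.card_subtype_compl, hk]
      simp
    obtain ⟨M, hM, hM'⟩ := ih (V := {v // v ≠ t}) (hA.eliminate ht₀' ht₁' ht)
      (L := fun v => L v)
      { source := fun i n => hL.source i n
        sink := fun j n => hL.sink j n
        step := by
          intro v h₀ h₁ n
          rw [hL.step v (fun ⟨j, hj⟩ => h₀ ⟨j, Subtype.ext hj⟩)
            (fun ⟨j, hj⟩ => h₁ ⟨j, Subtype.ext hj⟩), ← sum_eliminate_mul hA hL ht₀ ht₁ ht]
          rfl }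
      hcard
    refine ⟨M, (transformsInto_eliminate hA ht₁ ht).trans hM, fun n => ?_⟩
    rw [← hM', trailSum, trailSum]
    refine Finset.sum_congr rfl fun i _ => ?_
    rw [← sum_eliminate_mul hA hL ht₀ ht₁ ht]
    rfl

/-! ### Paths and cycles in meteor graphs -/

section

variable {G : MultiDigraph.{u, v}}

theorem isPath_iff_map {a b : G.V} {l : List G.E} :
    G.IsPath a l b ↔ l.map G.s ++ [b] = a :: l.map G.r := by
  induction l generalizing a with
  | nil => simp [IsPath, eq_comm]
  | cons e l ih => simp [IsPath, ih]

theorem isPath_append {a b : G.V} {l l' : List G.E} :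
    G.IsPath a (l ++ l') b ↔ ∃ c, G.IsPath a l c ∧ G.IsPath c l' b := by
  induction l generalizing a with
  | nil => simp [IsPath]
  | cons e l ih => simp [IsPath, ih, and_assoc]

theorem IsPath.append {a b c : G.V} {l l' : List G.E} (h : G.IsPath a l b) (h' : G.IsPath b l' c) :
    G.IsPath a (l ++ l') c :=
  isPath_append.mpr ⟨b, h, h'⟩

/-- The end of a simple path, from one of its vertices on. -/
theorem IsPath.exists_nodup_of_mem {a b c : G.V} {l : List G.E} (h : G.IsPath c l b)
    (hl : (l.map G.s ++ [b]).Nodup) (ha : a ∈ l.map G.s ++ [b]) :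
    ∃ l', G.IsPath a l' b ∧ (l'.map G.s ++ [b]).Nodup := by
  induction l generalizing c with
  | nil =>
    obtain rfl : a = b := by simpa using ha
    exact ⟨[], rfl, hl⟩
  | cons e l ih =>
    rw [List.map_cons, List.cons_append] at ha
    rcases List.mem_cons.mp ha with rfl | ha
    · exact ⟨e :: l, ⟨rfl, h.2⟩, hl⟩
    · exact ih h.2 (List.nodup_cons.mp hl).2 ha

theorem IsPath.exists_nodup {a b : G.V} {l : List G.E} (h : G.IsPath a l b) :
    ∃ l', G.IsPath a l' b ∧ (l'.map G.s ++ [b]).Nodup := by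
  induction l generalizing a with
  | nil => exact ⟨[], h, by simp⟩
  | cons e l ih =>
    obtain ⟨l', hl', hn⟩ := ih h.2
    by_cases ha : a ∈ l'.map G.s ++ [b]
    · exact hl'.exists_nodup_of_mem hn ha
    · refine ⟨e :: l', ⟨h.1, hl'⟩, ?_⟩
      rw [List.map_cons, List.cons_append, h.1]
      exact List.nodup_cons.mpr ⟨ha, hn⟩

/-- An edge whose range is connected to its source by a path lies on a cycle. -/
theorem exists_isCycle_of_isPath {e : G.E} {l : List G.E} (h : G.IsPath (G.r e) l (G.s e)) :
    ∃ c, G.IsCycle c ∧ e ∈ c := by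
  obtain ⟨l', hl', hn⟩ := h.exists_nodup
  refine ⟨e :: l', ⟨by simp, ⟨G.s e, rfl, hl'⟩, ?_, ?_⟩, by simp⟩
  · rw [List.map_cons]
    exact (List.perm_append_singleton _ _).nodup_iff.mp hn
  · rw [isPath_iff_map] at hl'
    rwa [List.map_cons, ← hl']

/-- A cycle can be parametrized by the residue classes modulo its length, starting at a given
vertex. -/
theorem IsCycle.exists_param {c : List G.E} (hc : G.IsCycle c) {p : ℕ} [NeZero p]
    (hp : c.length = p) {x : G.V} (hx : x ∈ G.verts c) :
    ∃ ε : ZMod p → G.E, G.s (ε 0) = x ∧ (∀ i, G.r (ε i) = G.s (ε (i + 1))) ∧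
      Function.Injective (fun i => G.s (ε i)) ∧ (∀ e, e ∈ c ↔ ∃ i, ε i = e) ∧
      ∀ a, a ∈ G.verts c ↔ ∃ i, G.s (ε i) = a := by
  obtain ⟨-, ⟨a, ha⟩, hs, -⟩ := hc
  rw [isPath_iff_map] at ha
  have hlt : ∀ i : ZMod p, i.val < c.length := fun i => hp ▸ ZMod.val_lt i
  let ε : ZMod p → G.E := fun i => c.get ⟨i.val, hlt i⟩
  have hε : ∀ e, e ∈ c ↔ ∃ i, ε i = e := by
    intro e
    constructor
    · intro he
      obtain ⟨k, hk, rfl⟩ := List.mem_iff_getElem.mp he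
      refine ⟨k, ?_⟩
      have : (k : ZMod p).val = k := ZMod.val_cast_of_lt (hp ▸ hk)
      simp [ε, this]
    · rintro ⟨i, rfl⟩
      exact List.getElem_mem _
  have hinj : Function.Injective fun i => G.s (ε i) := by
    intro i k h
    apply ZMod.val_injective p
    have := (List.Nodup.getElem_inj_iff hs (i := i.val) (hi := by simpa using hlt i)
      (j := k.val) (hj := by simpa using hlt k)).mp (by simpa [ε] using h)
    exact this
  have hstep : ∀ i, G.r (ε i) = G.s (ε (i + 1)) := by
    intro i
    have h₁ := congrArg (fun l => l[i.val + 1]?) ha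
    have h₀ := congrArg (fun l => l[0]?) ha
    have hv : (i + 1).val = (i.val + 1) % p := by
      rw [ZMod.val_add, ZMod.val_one_eq_one_mod]
      simp
    have hc0 : 0 < c.length := hp ▸ NeZero.pos p
    have hi := hlt i
    simp only [List.getElem?_cons_succ, List.getElem?_map] at h₁
    rw [List.getElem?_eq_getElem hi] at h₁
    rcases Nat.lt_or_ge (i.val + 1) p with h | h
    · rw [Nat.mod_eq_of_lt h] at hv
      rw [List.getElem?_append_left (by simpa [hp] using h), List.getElem?_map,
        List.getElem?_eq_getElem (hp ▸ h)] at h₁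
      simp only [ε, hv]
      simpa using h₁.symm
    · have hip : i.val + 1 = p := by omega
      rw [hip, Nat.mod_self] at hv
      rw [List.getElem?_append_right (by simp [hip, hp])] at h₁
      rw [List.getElem?_append_left (by simpa using hc0), List.getElem?_map,
        List.getElem?_eq_getElem hc0] at h₀
      simp only [ε, hv]
      simp [hip, hp] at h₁ h₀
      exact (h₀.trans h₁).symm
  have hverts : ∀ a, a ∈ G.verts c ↔ ∃ i, G.s (ε i) = a := by
    intro a
    constructor
    · rintro ⟨e, he, h⟩
      obtain ⟨i, rfl⟩ := (hε e).mp he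
      rcases h with rfl | rfl
      · exact ⟨i, rfl⟩
      · exact ⟨i + 1, (hstep i).symm⟩
    · rintro ⟨i, rfl⟩
      exact ⟨ε i, (hε _).mpr ⟨i, rfl⟩, Or.inl rfl⟩
  obtain ⟨k, hk⟩ := (hverts x).mp hx
  refine ⟨fun i => ε (i + k), by simpa using hk, fun i => ?_, fun i j h => ?_, fun e => ?_,
    fun a => ?_⟩
  · rw [hstep, add_right_comm]
  · exact add_right_cancel (hinj h)
  · rw [hε, (Equiv.addRight k).surjective.exists]
    rfl
  · rw [hverts, (Equiv.addRight k).surjective.exists]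
    rfl

theorem exists_isPath_add {p : ℕ} {ε : ZMod p → G.E} (h : ∀ i, G.r (ε i) = G.s (ε (i + 1)))
    (i : ZMod p) (k : ℕ) : ∃ l, G.IsPath (G.s (ε i)) l (G.s (ε (i + k))) := by
  induction k generalizing i with
  | zero => exact ⟨[], by simp [IsPath]⟩
  | succ k ih =>
    obtain ⟨l, hl⟩ := ih (i + 1)
    refine ⟨ε i :: l, rfl, ?_⟩
    rw [h]
    convert hl using 3
    push_cast
    ring

theorem exists_isPath_param {p : ℕ} [NeZero p] {ε : ZMod p → G.E}
    (h : ∀ i, G.r (ε i) = G.s (ε (i + 1))) (i k : ZMod p) :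
    ∃ l, G.IsPath (G.s (ε i)) l (G.s (ε k)) := by
  simpa using exists_isPath_add h i (k - i).val

theorem IsCycle.exists_isPath {c : List G.E} (hc : G.IsCycle c) {a b : G.V} (ha : a ∈ G.verts c)
    (hb : b ∈ G.verts c) : ∃ l, G.IsPath a l b := by
  have : NeZero c.length := ⟨by simpa using hc.1⟩
  obtain ⟨ε, h₀, h, -, -, hv⟩ := hc.exists_param rfl ha
  obtain ⟨k, rfl⟩ := (hv b).mp hb
  rw [← h₀]
  exact exists_isPath_param h 0 k

theorem exists_isPath_length_eq_pathDist {a b : G.V} (h : ∃ l, G.IsPath a l b) :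
    ∃ l, G.IsPath a l b ∧ l.length = G.pathDist a b := by
  obtain ⟨l, hl⟩ := h
  exact Nat.sInf_mem (s := {n | ∃ l, G.IsPath a l b ∧ l.length = n}) ⟨_, l, hl, rfl⟩

variable {c₀ c₁ : List G.E}

theorem IsMeteorWith.not_isPath (hG : G.IsMeteorWith c₀ c₁) {e : G.E} (h₀ : e ∉ c₀) (h₁ : e ∉ c₁)
    (l : List G.E) : ¬ G.IsPath (G.r e) l (G.s e) := by
  intro h
  obtain ⟨c, hc, he⟩ := exists_isCycle_of_isPath h
  rcases hG.only_cycles c hc with h | h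
  · exact h₀ (h.mem_iff.mp he)
  · exact h₁ (h.mem_iff.mp he)

/-- The source cycle receives no edges except for its own: an edge into it that starts elsewhere
would close up to a further cycle. -/
theorem IsMeteorWith.mem_of_r_mem (hG : G.IsMeteorWith c₀ c₁) {e : G.E}
    (h : G.r e ∈ G.verts c₀) : e ∈ c₀ := by
  by_contra h₀
  rcases hG.edges e with he | he | ⟨a, ha, b, hb, l, hl, he⟩
  · exact h₀ he
  · exact hG.disj.le_bot ⟨h, e, he, Or.inr rfl⟩
  · have h₁ : e ∉ c₁ := fun he => hG.disj.le_bot ⟨h, e, he, Or.inr rfl⟩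
    obtain ⟨l₁, l₂, rfl⟩ := List.append_of_mem he
    obtain ⟨x, hx, rfl, -⟩ := isPath_append.mp hl
    obtain ⟨l', hl'⟩ := hG.cycle₀.exists_isPath h ha
    exact hG.not_isPath h₀ h₁ _ (hl'.append hx)

/-- The sink cycle emits no edges except for its own. -/
theorem IsMeteorWith.mem_of_s_mem (hG : G.IsMeteorWith c₀ c₁) {e : G.E}
    (h : G.s e ∈ G.verts c₁) : e ∈ c₁ := by
  by_contra h₁
  rcases hG.edges e with he | he | ⟨a, ha, b, hb, l, hl, he⟩
  · exact hG.disj.le_bot ⟨⟨e, he, Or.inl rfl⟩, h⟩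
  · exact h₁ he
  · have h₀ : e ∉ c₀ := fun he => hG.disj.le_bot ⟨⟨e, he, Or.inl rfl⟩, h⟩
    obtain ⟨l₁, l₂, rfl⟩ := List.append_of_mem he
    obtain ⟨x, -, -, hx⟩ := isPath_append.mp hl
    obtain ⟨l', hl'⟩ := hG.cycle₁.exists_isPath hb h
    exact hG.not_isPath h₀ h₁ _ (hx.append hl')

/-- Off the cycles, the number of reachable vertices decreases along every edge. -/
theorem IsMeteorWith.ncard_reachable_lt (hG : G.IsMeteorWith c₀ c₁) {e : G.E} (h₀ : e ∉ c₀)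
    (h₁ : e ∉ c₁) :
    {w | ∃ l, G.IsPath (G.r e) l w}.ncard < {w | ∃ l, G.IsPath (G.s e) l w}.ncard := by
  have := hG.finite_V
  refine Set.ncard_lt_ncard ⟨?_, fun h => ?_⟩ (Set.toFinite _)
  · rintro w ⟨l, hl⟩
    exact ⟨e :: l, rfl, hl⟩
  · obtain ⟨l, hl⟩ := h ⟨[], rfl⟩
    exact hG.not_isPath h₀ h₁ l hl

/-- A path that ends in the source cycle never leaves it, so its length is determined modulo the
length of the cycle. -/
theorem IsMeteorWith.natCast_pathDist_source (hG : G.IsMeteorWith c₀ c₁) {p : ℕ} [NeZero p]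
    {ε : ZMod p → G.E} (hε : ∀ i, G.r (ε i) = G.s (ε (i + 1)))
    (hinj : Function.Injective fun i => G.s (ε i)) (hmem : ∀ e, e ∈ c₀ ↔ ∃ i, ε i = e)
    (i k : ZMod p) : (G.pathDist (G.s (ε i)) (G.s (ε k)) : ZMod p) = k - i := by
  have key : ∀ (l : List G.E) (a : G.V), G.IsPath a l (G.s (ε k)) →
      a = G.s (ε (k - l.length)) := by
    intro l
    induction l with
    | nil => intro a h; simpa [IsPath] using h
    | cons e l ih =>
      rintro a ⟨rfl, h⟩
      have hr := ih _ h
      have he : e ∈ c₀ := hG.mem_of_r_mem <|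
        ⟨ε (k - l.length), (hmem _).mpr ⟨_, rfl⟩, Or.inl hr.symm⟩
      obtain ⟨j, rfl⟩ := (hmem e).mp he
      rw [hε] at hr
      have := hinj hr
      rw [List.length_cons, Nat.cast_succ, ← sub_sub, ← this, add_sub_cancel_right]
  obtain ⟨l, hl, hlen⟩ := exists_isPath_length_eq_pathDist (exists_isPath_param hε i k)
  have := hinj (key l _ hl)
  rw [← hlen, this, sub_sub_cancel]

/-- A path that begins in the sink cycle never leaves it, so its length is determined modulo the
length of the cycle. -/
theorem IsMeteorWith.natCast_pathDist_sink (hG : G.IsMeteorWith c₀ c₁) {q : ℕ} [NeZero q]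
    {ε : ZMod q → G.E} (hε : ∀ i, G.r (ε i) = G.s (ε (i + 1)))
    (hinj : Function.Injective fun i => G.s (ε i)) (hmem : ∀ e, e ∈ c₁ ↔ ∃ i, ε i = e)
    (i k : ZMod q) : (G.pathDist (G.s (ε i)) (G.s (ε k)) : ZMod q) = k - i := by
  have key : ∀ (l : List G.E) (j : ZMod q) (b : G.V), G.IsPath (G.s (ε j)) l b →
      b = G.s (ε (j + l.length)) := by
    intro l
    induction l with
    | nil => intro j b h; simpa [IsPath, eq_comm] using h
    | cons e l ih =>
      rintro j b ⟨hs, h⟩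
      have he : e ∈ c₁ := hG.mem_of_s_mem <|
        ⟨ε j, (hmem _).mpr ⟨_, rfl⟩, Or.inl hs.symm⟩
      obtain ⟨j', rfl⟩ := (hmem e).mp he
      obtain rfl : j' = j := hinj hs
      rw [hε] at h
      rw [ih _ _ h, List.length_cons, Nat.cast_succ, add_right_comm, add_assoc]
  obtain ⟨l, hl, hlen⟩ := exists_isPath_length_eq_pathDist (exists_isPath_param hε i k)
  have := hinj (key l i _ hl)
  rw [← hlen, this, add_sub_cancel_left]

/-- The paths that begin in `a`, avoid the source cycle, end in the sink cycle and stop as soon as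
they meet it; here `n` is the class modulo `d` of the length, prolonged by the distance to `y`. -/
def pathSet (G : MultiDigraph.{u, v}) (c₀ c₁ : List G.E) (d : ℕ) (y a : G.V) (n : ZMod d) :
    Set (List G.E) :=
  {l | ∃ b, G.IsPath a l b ∧ b ∈ G.verts c₁ ∧ (∀ e ∈ l, G.s e ∉ G.verts c₀ ∪ G.verts c₁) ∧
    ((l.length + G.pathDist b y : ℕ) : ZMod d) = n}

/-- The lists that consist of an edge with source `a` and of a continuation, which is taken from a
set depending on the range of this edge, are counted with the help of the adjacency matrix. -/
theorem encard_cons [Finite G.E] {V : Type} [Fintype V] (φ : V ≃ G.V) (a : G.V)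
    (B : G.V → Set (List G.E)) :
    {l | ∃ e l', l = e :: l' ∧ G.s e = a ∧ l' ∈ B (G.r e)}.encard =
      ∑ w, (Nat.card {e // G.s e = a ∧ G.r e = φ w} : ℕ∞) * (B (φ w)).encard := by
  let T : V → Set (List G.E) := fun w =>
    (fun x : G.E × List G.E => x.1 :: x.2) '' ({e | G.s e = a ∧ G.r e = φ w} ×ˢ B (φ w))
  have hT : {l | ∃ e l', l = e :: l' ∧ G.s e = a ∧ l' ∈ B (G.r e)} = ⋃ w, T w := by
    ext l
    simp only [T, Set.mem_iUnion, Set.mem_image, Set.mem_prod, Prod.exists, Set.mem_ofPred_eq]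
    constructor
    · rintro ⟨e, l', rfl, h, h'⟩
      exact ⟨φ.symm (G.r e), e, l', by simpa using ⟨h, h'⟩, rfl⟩
    · rintro ⟨w, e, l', ⟨⟨h, h'⟩, h''⟩, rfl⟩
      exact ⟨e, l', rfl, h, h' ▸ h''⟩
  rw [hT, Set.encard_iUnion_of_finite, finsum_eq_sum_of_fintype]
  · refine Finset.sum_congr rfl fun w _ => ?_
    rw [Function.Injective.encard_image, Set.encard_prod,
      ← Set.Finite.cast_ncard_eq (Set.toFinite _)]
    · rfl
    · rintro ⟨e, l⟩ ⟨e', l'⟩ h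
      simpa using h
  · intro w w' hw
    refine Set.disjoint_left.mpr ?_
    rintro _ ⟨⟨e, l⟩, ⟨⟨-, h⟩, -⟩, rfl⟩ ⟨⟨e', l'⟩, ⟨⟨-, h'⟩, -⟩, h''⟩
    obtain ⟨rfl, rfl⟩ : e' = e ∧ l' = l := by simpa using h''
    exact hw (φ.injective (h.symm.trans h'))

/-! ### Counting trails -/

theorem IsMeteorWith.pathSet_source (hG : G.IsMeteorWith c₀ c₁) (d : ℕ) (y : G.V) {a : G.V}
    (ha : a ∈ G.verts c₀) (n : ZMod d) : G.pathSet c₀ c₁ d y a n = ∅ := by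
  refine Set.eq_empty_of_forall_notMem ?_
  rintro (_ | ⟨e, l⟩) ⟨b, hl, hb, hs, -⟩
  · obtain rfl : a = b := hl
    exact hG.disj.le_bot ⟨ha, hb⟩
  · obtain ⟨rfl, -⟩ := hl
    exact hs e (by simp) (Or.inl ha)

theorem encard_pathSet_sink (d : ℕ) (y : G.V) {a : G.V} (ha : a ∈ G.verts c₁) (n : ZMod d) :
    (G.pathSet c₀ c₁ d y a n).encard = if (G.pathDist a y : ZMod d) = n then 1 else 0 := by
  have : ∀ l ∈ G.pathSet c₀ c₁ d y a n, l = [] ∧ (G.pathDist a y : ZMod d) = n := by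
    rintro (_ | ⟨e, l⟩) ⟨b, hl, hb, hs, hn⟩
    · obtain rfl : a = b := hl
      exact ⟨rfl, by simpa using hn⟩
    · obtain ⟨rfl, -⟩ := hl
      exact absurd (Or.inr ha) (hs e (by simp))
  split_ifs with h
  · rw [Set.encard_eq_one]
    refine ⟨[], Set.eq_singleton_iff_unique_mem.mpr ⟨⟨a, rfl, ha, by simp, by simpa using h⟩,
      fun l hl => (this l hl).1⟩⟩
  · rw [Set.encard_eq_zero]
    exact Set.eq_empty_of_forall_notMem fun l hl => h (this l hl).2

theorem encard_pathSet_step [Finite G.E] {V : Type} [Fintype V] (φ : V ≃ G.V) (d : ℕ) (y : G.V)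
    {a : G.V} (h₀ : a ∉ G.verts c₀) (h₁ : a ∉ G.verts c₁) (n : ZMod d) :
    (G.pathSet c₀ c₁ d y a n).encard =
      ∑ w, (Nat.card {e // G.s e = a ∧ G.r e = φ w} : ℕ∞) *
        (G.pathSet c₀ c₁ d y (φ w) (n - 1)).encard := by
  rw [← encard_cons φ a fun w => G.pathSet c₀ c₁ d y w (n - 1)]
  congr 1
  ext (_ | ⟨e, l⟩)
  · constructor
    · rintro ⟨b, hl, hb, -⟩
      obtain rfl : a = b := hl
      exact absurd hb h₁
    · rintro ⟨e, l', h, -⟩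
      simp at h
  · constructor
    · rintro ⟨b, ⟨hs, hl⟩, hb, he, hn⟩
      refine ⟨e, l, rfl, hs, b, hl, hb, fun e' he' => he e' (List.mem_cons_of_mem _ he'), ?_⟩
      rw [← hn, List.length_cons]
      push_cast
      ring
    · rintro ⟨e', l', h, rfl, b, hl, hb, he, hn⟩
      obtain ⟨rfl, rfl⟩ : e = e' ∧ l = l' := by simpa using h
      refine ⟨b, ⟨rfl, hl⟩, hb, ?_, ?_⟩
      · intro f hf
        rcases List.mem_cons.mp hf with rfl | hf
        · simp [h₀, h₁]
        · exact he f hf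
      · rw [eq_sub_iff_add_eq] at hn
        rw [← hn, List.length_cons]
        push_cast
        ring

/-- A trail consists of an edge with source on the source cycle and of a path that avoids this cycle
and stops as soon as it meets the sink cycle. -/
theorem IsMeteorWith.trailCount_eq (hG : G.IsMeteorWith c₀ c₁) {p : ℕ} [NeZero p] {V : Type}
    [Fintype V] (φ : V ≃ G.V) (d : ℕ) (x y : G.V) {a : ZMod p → G.V}
    (ha : Function.Injective a) (hv : ∀ b, b ∈ G.verts c₀ ↔ ∃ i, a i = b) (n : ZMod d) :
    G.trailCount c₀ c₁ d x y n =
      ∑ i, ∑ w, (Nat.card {e // G.s e = a i ∧ G.r e = φ w} : ℕ∞) *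
        (G.pathSet c₀ c₁ d y (φ w) (n - 1 - G.pathDist x (a i))).encard := by
  have := hG.finite_E
  let T : ZMod p → Set (List G.E) := fun i => {l | ∃ e l', l = e :: l' ∧ G.s e = a i ∧
    l' ∈ G.pathSet c₀ c₁ d y (G.r e) (n - 1 - G.pathDist x (a i))}
  have hT : {l : List G.E | ∃ a b, G.IsTrail c₀ c₁ a l b ∧
      ((G.pathDist x a + l.length + G.pathDist b y : ℕ) : ZMod d) = n} = ⋃ i, T i := by
    ext l
    simp only [Set.mem_iUnion]
    constructor
    · rintro ⟨a', b, ⟨hne, hl, ha', hb, hs⟩, hn⟩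
      obtain ⟨i, rfl⟩ := (hv a').mp ha'
      obtain ⟨e, l, rfl⟩ := List.exists_cons_of_ne_nil hne
      refine ⟨i, e, l, rfl, hl.1, b, hl.2, hb, hs, ?_⟩
      rw [← hn, List.length_cons]
      push_cast
      ring
    · rintro ⟨i, e, l', rfl, he, b, hl, hb, hs, hn⟩
      refine ⟨a i, b, ⟨by simp, ⟨he, hl⟩, (hv _).mpr ⟨i, rfl⟩, hb, hs⟩, ?_⟩
      rw [eq_sub_iff_add_eq, eq_sub_iff_add_eq] at hn
      rw [← hn, List.length_cons]
      push_cast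
      ring
  rw [trailCount, hT, Set.encard_iUnion_of_finite, finsum_eq_sum_of_fintype]
  · exact Finset.sum_congr rfl fun i _ => encard_cons φ (a i)
      fun w => G.pathSet c₀ c₁ d y w (n - 1 - G.pathDist x (a i))
  · intro i k hik
    refine Set.disjoint_left.mpr ?_
    rintro _ ⟨e, l, rfl, he, -⟩ ⟨e', l', h, he', -⟩
    obtain ⟨rfl, -⟩ : e = e' ∧ l = l' := by simpa using h
    exact hik (ha (he.symm.trans he'))

/-- Every meteor graph can be transformed into a graph that consists of two cycles and of edges that
connect them, and the class sums of the connection matrix are the numbers of trails. -/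
theorem IsMeteorWith.exists_twoCycleMatrix (hG : G.IsMeteorWith c₀ c₁) {p q : ℕ} [NeZero p]
    [NeZero q] (hp : c₀.length = p) (hq : c₁.length = q) {x y : G.V} (hx : x ∈ G.verts c₀)
    (hy : y ∈ G.verts c₁) :
    ∃ M : Matrix (ZMod p) (ZMod q) ℕ, G.TransformsInto (ofMatrix (twoCycleMatrix M)) ∧
      ∀ n, G.trailCount c₀ c₁ (p.gcd q) x y n = classSum M (n - 1) := by
  have := hG.finite_V
  have := hG.finite_E
  obtain ⟨ε₀, rfl, h₀, hinj₀, hmem₀, hv₀⟩ := hG.cycle₀.exists_param hp hx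
  obtain ⟨ε₁, rfl, h₁, hinj₁, hmem₁, hv₁⟩ := hG.cycle₁.exists_param hq hy
  let φ : Fin (Nat.card G.V) ≃ G.V := (Finite.equivFin G.V).symm
  let A : Matrix (Fin (Nat.card G.V)) (Fin (Nat.card G.V)) ℕ :=
    Matrix.of fun a b => Nat.card {e // G.s e = φ a ∧ G.r e = φ b}
  have hA : ∀ a b, A a b = Nat.card {e // G.s e = φ a ∧ G.r e = φ b} := fun _ _ => rfl
  let f₀ : ZMod p → Fin (Nat.card G.V) := fun i => φ.symm (G.s (ε₀ i))
  let f₁ : ZMod q → Fin (Nat.card G.V) := fun j => φ.symm (G.s (ε₁ j))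
  have hf₀ : ∀ i, φ (f₀ i) = G.s (ε₀ i) := fun i => φ.apply_symm_apply _
  have hf₁ : ∀ j, φ (f₁ j) = G.s (ε₁ j) := fun j => φ.apply_symm_apply _
  have hr₀ : ∀ v, v ∈ Set.range f₀ ↔ φ v ∈ G.verts c₀ := fun v => by
    simp only [hv₀, Set.mem_range, f₀, Equiv.symm_apply_eq]
  have hr₁ : ∀ v, v ∈ Set.range f₁ ↔ φ v ∈ G.verts c₁ := fun v => by
    simp only [hv₁, Set.mem_range, f₁, Equiv.symm_apply_eq]
  have hne : ∀ a b, A a b ≠ 0 ↔ ∃ e, G.s e = φ a ∧ G.r e = φ b := fun a b => by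
    rw [hA, Nat.card_ne_zero, nonempty_subtype]
    exact and_iff_left inferInstance
  have hunique : ∀ a b (e : G.E) (P : Prop) [Decidable P],
      (∀ f, (G.s f = φ a ∧ G.r f = φ b) ↔ (f = e ∧ P)) → A a b = if P then 1 else 0 := by
    intro a b e P _ h
    rw [hA, Nat.card_congr (Equiv.subtypeEquivRight h)]
    split_ifs with hP <;> simp [hP]
  have hM : IsMeteorMatrix A f₀ f₁ :=
    { inj₀ := fun i k h => hinj₀ (φ.symm.injective h)
      inj₁ := fun i k h => hinj₁ (φ.symm.injective h)
      disj := fun i j h => hG.disj.le_bot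
        ⟨(hv₀ _).mpr ⟨i, rfl⟩, (hv₁ _).mpr ⟨j, (φ.symm.injective h).symm⟩⟩
      col₀ := by
        intro v i
        refine hunique v (f₀ i) (ε₀ (i - 1)) _ fun e => ?_
        have hr : G.r (ε₀ (i - 1)) = G.s (ε₀ i) := by rw [h₀, sub_add_cancel]
        rw [hf₀]
        constructor
        · rintro ⟨hs, hr'⟩
          obtain ⟨k, rfl⟩ := (hmem₀ e).mp (hG.mem_of_r_mem ((hv₀ _).mpr ⟨i, hr'.symm⟩))
          rw [h₀] at hr'
          obtain rfl : k + 1 = i := hinj₀ hr'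
          rw [add_sub_cancel_right]
          exact ⟨rfl, by simp [f₀, hs]⟩
        · rintro ⟨rfl, rfl⟩
          exact ⟨(hf₀ _).symm, hr⟩
      row₁ := by
        intro j v
        refine hunique (f₁ j) v (ε₁ j) _ fun e => ?_
        rw [hf₁]
        constructor
        · rintro ⟨hs, hr⟩
          obtain ⟨k, rfl⟩ := (hmem₁ e).mp (hG.mem_of_s_mem ((hv₁ _).mpr ⟨j, hs.symm⟩))
          obtain rfl : k = j := hinj₁ hs
          rw [h₁] at hr
          exact ⟨rfl, by simp [f₁, hr]⟩
        · rintro ⟨rfl, rfl⟩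
          exact ⟨rfl, by rw [hf₁, h₁]⟩
      nondegenerate := by
        constructor
        · intro v
          obtain ⟨e, he⟩ := (hG.essential (φ v)).1
          exact ⟨φ.symm (G.r e), (hne _ _).mpr ⟨e, he, by simp⟩⟩
        · intro v
          obtain ⟨e, he⟩ := (hG.essential (φ v)).2
          exact ⟨φ.symm (G.s e), (hne _ _).mpr ⟨e, by simp, he⟩⟩
      exists_rank := by
        refine ⟨fun v => {w | ∃ l, G.IsPath (φ v) l w}.ncard, fun v w h hv hv' _ => ?_⟩
        obtain ⟨e, hs, hr⟩ := (hne v w).mp h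
        rw [hr₀] at hv
        rw [hr₁] at hv'
        beta_reduce
        rw [← hs, ← hr]
        exact hG.ncard_reachable_lt (fun he => hv ⟨e, he, Or.inl hs⟩)
          (fun he => hv' ⟨e, he, Or.inl hs⟩) }
  have hL : IsPathCount A f₀ f₁
      fun v n => (G.pathSet c₀ c₁ (p.gcd q) (G.s (ε₁ 0)) (φ v) n).encard :=
    { source := fun i n => by
        rw [hG.pathSet_source _ _ ((hr₀ _).mp ⟨i, rfl⟩), Set.encard_empty]
      sink := fun j n => by
        rw [encard_pathSet_sink _ _ ((hr₁ _).mp ⟨j, rfl⟩), hf₁]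
        have := congrArg (ZMod.castHom (Nat.gcd_dvd_right p q) (ZMod (p.gcd q)))
          (hG.natCast_pathDist_sink h₁ hinj₁ hmem₁ j 0)
        rw [map_natCast, map_sub, map_zero] at this
        rw [this, connClass, map_zero]
      step := fun v h h' n => by
        rw [hr₀] at h
        rw [hr₁] at h'
        exact encard_pathSet_step φ _ _ h h' n }
  obtain ⟨i⟩ := exists_iso_ofMatrix φ A fun a b => (hA a b).symm
  obtain ⟨M, hAM, hsum⟩ := hM.exists_twoCycleMatrix hL
  refine ⟨M, i.transformsInto.trans hAM, fun n => ?_⟩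
  rw [← hsum, hG.trailCount_eq φ _ _ _ hinj₀ hv₀, trailSum]
  refine Finset.sum_congr rfl fun k _ => ?_
  have := congrArg (ZMod.castHom (Nat.gcd_dvd_left p q) (ZMod (p.gcd q)))
    (hG.natCast_pathDist_source h₀ hinj₀ hmem₀ 0 k)
  rw [map_natCast, map_sub, map_zero] at this
  rw [this, connClass, map_zero]
  simp only [hA, hf₀]

end

end MultiDigraph

open MultiDigraph in
theorem proposition4p12 (E F : MultiDigraph.{u, v}) (hE : E.IsMeteor) (hF : F.IsMeteor)
    (h : E.Approx F) : E.TransformsInto F := by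
  obtain ⟨c₀, c₁, c₀', c₁', hE', hF', x, hx, y, hy, x', hx', y', hy', hp, hq, t, ht⟩ := h
  have : NeZero c₀.length := ⟨by simpa using hE'.cycle₀.1⟩
  have : NeZero c₁.length := ⟨by simpa using hE'.cycle₁.1⟩
  obtain ⟨M, hM, hM'⟩ := hE'.exists_twoCycleMatrix rfl rfl hx hy
  obtain ⟨N, hN, hN'⟩ := hF'.exists_twoCycleMatrix hp.symm hq.symm hx' hy'
  -- The class sums at `n` count the trails of class `n + 1`.
  refine (hM.trans (connEquiv_of_classSum_add_eq t fun n => ?_)).trans (transformsInto_symm hN)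
  have := ht (n + 1)
  rw [hM', hN', add_sub_cancel_right, add_right_comm, add_sub_cancel_right] at this
  exact_mod_cast this
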